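/- Write $\mathbb{N}=\{0,1,2,\dots\}$, $-\mathbb{N}=\{0,-1,-2,\dots\}$, and $(t)_0=1$, $(t)_{n+1}=(t+n)(t)_n$. Let $a,b,p,q,r\in\mathbb{R}$ with $r\notin-\mathbb{N}$, and for $0<x<1$ put $$h(x)=x^{a-1}(1-x)^{b-1}\,{}_2F_1(p,q;r;x),\qquad {}_2F_1(p,q;r;x)=\sum_{n=0}^\infty\frac{(p)_n(q)_n}{n!\,(r)_n}x^n .$$ Assume that $h\ge 0$ on $(0,1)$; this is the case in particular when $(p,q,r)\in\mathbb{P}$, that is, when ${}_2F_1(p,q;r;x)>0$ for all $x\in(0,1)$. Consider the condition $$a>0,\qquad b>0,\qquad r+b-p-q>0. \tag{$*$}$$ 1. If $(*)$ holds, then $h$ is integrable on $(0,1)$, i.e. $\int_0^1h\,dx<\infty$, the series defining ${}_3F_2$ below converges, and $$\int_0^1 h(x)\,dx=B(a,b)\;{}_3F_2(p,q,a;r,a+b;1),$$ where $$B(a,b)=\frac{\Gamma(a)\Gamma(b)}{\Gamma(a+b)},\qquad {}_3F_2(p,q,a;r,a+b;1)=\sum_{n=0}^\infty\frac{(p)_n(q)_n(a)_n}{n!\,(r)_n(a+b)_n}.$$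 2. Conversely, suppose that either (i) $r-p-q\ge 0$, $r-p\notin-\mathbb{N}$ and $r-q\notin-\mathbb{N}$; or (ii) $r-p-q\le 0$, $p\notin-\mathbb{N}$ and $q\notin-\mathbb{N}$. If $\int_0^1h\,dx<\infty$, then $(*)$ holds. -/

import Mathlib

open Set MeasureTheory

/-- The rising factorial `(t)_n = t (t + 1) ⋯ (t + n - 1)`, with `(t)_0 = 1`. -/
noncomputable def pochhammer (t : ℝ) (n : ℕ) : ℝ := (ascPochhammer ℝ n).eval t

/-- The `n`-th term of the generalized hypergeometric series `₃F₂(A, B, C; D, E; x)`. -/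
noncomputable def hypergeometric3F2Term (A B C D E x : ℝ) (n : ℕ) : ℝ :=
  pochhammer A n * pochhammer B n * pochhammer C n /
    ((n.factorial : ℝ) * pochhammer D n * pochhammer E n) * x ^ n

/-- The generalized hypergeometric function `₃F₂(A, B, C; D, E; x)`, as the sum of its series. -/
noncomputable def hypergeometric3F2 (A B C D E x : ℝ) : ℝ :=
  ∑' n : ℕ, hypergeometric3F2Term A B C D E x n

/-- The function `h(a, b, p, q, r; x) = x^(a-1) (1-x)^(b-1) ₂F₁(p, q; r; x)`, used for `0 < x < 1`.
Here `₂F₁` is Mathlib's Gauss hypergeometric function, the sum of the power series with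
coefficients `(p)_n (q)_n / (n! (r)_n)`. -/
noncomputable def betaHypergeometricDensity (a b p q r x : ℝ) : ℝ :=
  x ^ (a - 1) * (1 - x) ^ (b - 1) * ordinaryHypergeometric p q r x

/-- `t ∉ -ℕ = {0, -1, -2, …}`. -/
def NotNonposInt (t : ℝ) : Prop := ∀ n : ℕ, t ≠ -(n : ℝ)

open Filter Topology

/-! Sufficiency is termwise integration. The `n`-th term of the Gauss series contributes a Beta
integral, `B(a + n, b) = B(a, b) (a)_n / (a + b)_n`, which produces exactly the `n`-th term of
`₃F₂`. By Euler's limit formula for `Γ` these terms are `O(n ^ (-(1 + r + b - p - q)))`, so under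
(*) they are absolutely summable and sum and integral may be exchanged.

Necessity is local at the endpoints. At `0` the function `₂F₁` tends to `1`, so `x ^ (a - 1)` must
be integrable there. At `1`, `|₂F₁|` is at least a positive multiple of `(1 - x) ^ (-max (p + q - r)
0)` (`exists_eventually_le_abs_ordinaryHypergeometric`), which forces `b > max (p + q - r) 0`, that
is, the last two inequalities of (*). Conditions (i) and (ii) keep the leading constant nonzero: for
`r - p - q ≤ 0` it involves `1 / (Γ(p) Γ(q))`; for `r - p - q > 0` it is the value of the series at
`1` (`tsum_gaussCoeff_ne_zero`). -/

/-! ### Rising factorials and the decay of hypergeometric terms -/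

lemma pochhammer_zero (t : ℝ) : pochhammer t 0 = 1 := by simp [pochhammer]

lemma pochhammer_succ (t : ℝ) (n : ℕ) : pochhammer t (n + 1) = pochhammer t n * (t + n) := by
  simp [pochhammer, ascPochhammer_succ_eval]

lemma pochhammer_one (n : ℕ) : pochhammer 1 n = n.factorial := by
  simp [pochhammer]

lemma pochhammer_eq_prod (t : ℝ) (n : ℕ) :
    pochhammer t n = ∏ j ∈ Finset.range n, (t + j) := by
  induction n with
  | zero => simp [pochhammer_zero]
  | succ n ih => rw [pochhammer_succ, ih, Finset.prod_range_succ]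

lemma pochhammer_ne_zero {t : ℝ} (ht : NotNonposInt t) (n : ℕ) : pochhammer t n ≠ 0 := by
  rw [pochhammer_eq_prod, Finset.prod_ne_zero_iff]
  intro j _ h
  exact ht j (by linarith)

lemma notNonposInt_of_pos {t : ℝ} (ht : 0 < t) : NotNonposInt t := by
  intro n h
  have : (0 : ℝ) ≤ n := n.cast_nonneg
  linarith

lemma pochhammer_pos {t : ℝ} (ht : 0 < t) (n : ℕ) : 0 < pochhammer t n := by
  rw [pochhammer_eq_prod]
  exact Finset.prod_pos fun j _ => by positivity

lemma NotNonposInt.add_natCast {t : ℝ} (ht : NotNonposInt t) (m : ℕ) : NotNonposInt (t + m) := by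
  intro n h
  exact ht (n + m) (by push_cast; linarith)

lemma Gamma_inv_ne_zero {t : ℝ} (ht : NotNonposInt t) : (Real.Gamma t)⁻¹ ≠ 0 :=
  inv_ne_zero (Real.Gamma_ne_zero ht)

/-- Euler's limit formula, for the rising factorial. -/
lemma tendsto_pochhammer_div (t : ℝ) :
    Tendsto (fun n : ℕ => pochhammer t (n + 1) / ((n : ℝ) ^ t * n.factorial)) atTop
      (𝓝 (Real.Gamma t)⁻¹) := by
  by_cases ht : NotNonposInt t
  · refine ((Real.GammaSeq_tendsto_Gamma t).inv₀ (Real.Gamma_ne_zero ht)).congr fun n => ?_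
    rw [Real.GammaSeq, inv_div, pochhammer_eq_prod]
  · simp only [NotNonposInt, not_forall, not_not] at ht
    obtain ⟨k, rfl⟩ := ht
    -- At a pole, `Real.Gamma` is `0` and `0⁻¹ = 0`, the correct value of `1 / Γ`; the product has a
    -- zero factor once `n ≥ k`.
    rw [Real.Gamma_neg_nat_eq_zero, inv_zero]
    refine tendsto_const_nhds.congr' ?_
    filter_upwards [eventually_ge_atTop k] with n hn
    rw [pochhammer_eq_prod, Finset.prod_eq_zero (i := k) (by simp; omega) (by simp), zero_div]

/-- Asymptotics of the terms of the series `₃F₂(A, B, C; D, E; 1)`. -/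
lemma tendsto_hypergeometric3F2Term_mul_rpow (A B C : ℝ) {D E : ℝ} (hD : NotNonposInt D)
    (hE : NotNonposInt E) :
    Tendsto (fun n : ℕ => hypergeometric3F2Term A B C D E 1 (n + 1) *
        (n : ℝ) ^ (1 + D + E - A - B - C)) atTop
      (𝓝 ((Real.Gamma A)⁻¹ * (Real.Gamma B)⁻¹ * (Real.Gamma C)⁻¹ /
        ((Real.Gamma 1)⁻¹ * (Real.Gamma D)⁻¹ * (Real.Gamma E)⁻¹))) := by
  have h := (((tendsto_pochhammer_div A).mul (tendsto_pochhammer_div B)).mul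
    (tendsto_pochhammer_div C)).div (((tendsto_pochhammer_div 1).mul
    (tendsto_pochhammer_div D)).mul (tendsto_pochhammer_div E))
    (mul_ne_zero (mul_ne_zero (Gamma_inv_ne_zero (notNonposInt_of_pos one_pos))
      (Gamma_inv_ne_zero hD)) (Gamma_inv_ne_zero hE))
  refine h.congr' ?_
  filter_upwards [eventually_ge_atTop 1] with n hn
  have hn' : (0 : ℝ) < n := by exact_mod_cast hn
  have e : (n : ℝ) ^ (1 + D + E - A - B - C) =
      n ^ (1 : ℝ) * n ^ D * n ^ E / (n ^ A * n ^ B * n ^ C) := by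
    rw [← Real.rpow_add hn', ← Real.rpow_add hn', ← Real.rpow_add hn', ← Real.rpow_add hn',
      ← Real.rpow_sub hn']
    ring_nf
  have hA := (Real.rpow_pos_of_pos hn' A).ne'
  have hB := (Real.rpow_pos_of_pos hn' B).ne'
  have hC := (Real.rpow_pos_of_pos hn' C).ne'
  have hf : (n.factorial : ℝ) ≠ 0 := by positivity
  have hD' := pochhammer_ne_zero hD (n + 1)
  have hE' := pochhammer_ne_zero hE (n + 1)
  have hf' : ((n + 1).factorial : ℝ) ≠ 0 := by positivity
  have hD'' := (Real.rpow_pos_of_pos hn' D).ne'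
  have hE'' := (Real.rpow_pos_of_pos hn' E).ne'
  simp only [e, hypergeometric3F2Term, Pi.div_apply, pochhammer_one, one_pow, mul_one]
  field_simp

lemma summable_hypergeometric3F2Term {A B C D E : ℝ} (hD : NotNonposInt D)
    (hE : NotNonposInt E) (h : 0 < D + E - A - B - C) :
    Summable (hypergeometric3F2Term A B C D E 1) := by
  rw [← summable_nat_add_iff 1]
  refine summable_of_isBigO_nat
    (Real.summable_nat_rpow_inv.2 (show 1 < 1 + D + E - A - B - C by linarith)) ?_
  have := (tendsto_hypergeometric3F2Term_mul_rpow A B C hD hE).isBigO_one ℝ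
  have h2 := this.mul (Asymptotics.isBigO_refl
    (fun n : ℕ => ((n : ℝ) ^ (1 + D + E - A - B - C))⁻¹) atTop)
  refine (h2.congr' ?_ ?_)
  · filter_upwards [eventually_ge_atTop 1] with n hn
    have hn' : (0 : ℝ) < n := by exact_mod_cast hn
    rw [mul_assoc, mul_inv_cancel₀ (Real.rpow_pos_of_pos hn' _).ne', mul_one]
  · exact Eventually.of_forall fun n => by simp

/-! ### The Gauss series at `1` -/

/-- The `n`-th coefficient of the Gauss hypergeometric series. -/
noncomputable def gaussCoeff (p q r : ℝ) (n : ℕ) : ℝ :=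
  pochhammer p n * pochhammer q n / ((n.factorial : ℝ) * pochhammer r n)

lemma ordinaryHypergeometric_eq_tsum_gaussCoeff (p q r x : ℝ) :
    ordinaryHypergeometric p q r x = ∑' n, gaussCoeff p q r n * x ^ n := by
  rw [ordinaryHypergeometric_eq_tsum]
  refine tsum_congr fun n => ?_
  simp only [gaussCoeff, pochhammer, smul_eq_mul]
  ring

/-- The extra parameters `1; 1` cancel, so the `₃F₂` asymptotics also cover `₂F₁`. -/
lemma gaussCoeff_eq (p q r : ℝ) : gaussCoeff p q r = hypergeometric3F2Term p q 1 r 1 1 := by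
  ext n
  simp only [gaussCoeff, hypergeometric3F2Term, one_pow, mul_one]
  rw [mul_div_mul_right _ _ (pochhammer_pos one_pos n).ne']

lemma tendsto_gaussCoeff_mul_rpow (p q : ℝ) {r : ℝ} (hr : NotNonposInt r) :
    Tendsto (fun n : ℕ => gaussCoeff p q r (n + 1) * (n : ℝ) ^ (1 + r - p - q)) atTop
      (𝓝 ((Real.Gamma p)⁻¹ * (Real.Gamma q)⁻¹ / (Real.Gamma r)⁻¹)) := by
  have := tendsto_hypergeometric3F2Term_mul_rpow p q 1 hr (notNonposInt_of_pos one_pos)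
  simp only [Real.Gamma_one, inv_one, mul_one, one_mul] at this
  rw [gaussCoeff_eq]
  convert this using 4
  ring

lemma summable_gaussCoeff {p q r : ℝ} (hr : NotNonposInt r) (h : 0 < r - p - q) :
    Summable (gaussCoeff p q r) := by
  rw [gaussCoeff_eq]
  exact summable_hypergeometric3F2Term hr (notNonposInt_of_pos one_pos) (by linarith)

lemma gaussCoeff_succ {p q r : ℝ} (hr : NotNonposInt r) (n : ℕ) :
    (n + 1) * (r + n) * gaussCoeff p q r (n + 1) = (p + n) * (q + n) * gaussCoeff p q r n := by
  have h1 := pochhammer_ne_zero hr n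
  have h2 : r + n ≠ 0 := fun h => hr n (by linarith)
  have h3 : (n.factorial : ℝ) ≠ 0 := by positivity
  have h4 : (n + 1 : ℝ) ≠ 0 := by positivity
  simp only [gaussCoeff, pochhammer_succ, Nat.factorial_succ]
  push_cast
  field_simp

lemma gaussCoeff_add_one {p q r : ℝ} (hr : NotNonposInt r) (n : ℕ) :
    r * gaussCoeff p q r n = (r + n) * gaussCoeff p q (r + 1) n := by
  have key : (r + n) * pochhammer r n = r * pochhammer (r + 1) n := by
    have h1 := Finset.prod_range_succ (fun j : ℕ => r + j) n
    rw [Finset.prod_range_succ'] at h1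
    rw [pochhammer_eq_prod, pochhammer_eq_prod, mul_comm, ← h1]
    push_cast
    rw [mul_comm, add_zero]
    congr 1
    exact Finset.prod_congr rfl fun j _ => by ring
  have h1 := pochhammer_ne_zero hr n
  have h2 : pochhammer (r + 1) n ≠ 0 := by
    have := pochhammer_ne_zero (hr.add_natCast 1) n
    simpa using this
  have h3 : (n.factorial : ℝ) ≠ 0 := by positivity
  simp only [gaussCoeff]
  field_simp
  linear_combination (-1 : ℝ) * pochhammer p n * pochhammer q n * key

/-- The contiguous relation behind Gauss's summation theorem. -/
lemma tsum_gaussCoeff_add_one {p q r : ℝ} (hr : NotNonposInt r) (h : 0 < r - p - q) :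
    r * (r - p - q) * ∑' n, gaussCoeff p q r n =
      (r - p) * (r - q) * ∑' n, gaussCoeff p q (r + 1) n := by
  have hr1 : NotNonposInt (r + 1) := by simpa using hr.add_natCast 1
  have hs := summable_gaussCoeff (p := p) (q := q) hr h
  have hs1 := summable_gaussCoeff (p := p) (q := q) hr1 (by linarith)
  have hsum := (hs.hasSum.mul_left (r * (r - p - q))).sub
    (hs1.hasSum.mul_left ((r - p) * (r - q)))
  -- The difference of the two series telescopes, leaving a boundary term of order `N ^ (-(r - p -
  -- q))`.
  have hpart : ∀ N : ℕ, ∑ n ∈ Finset.range N, (r * (r - p - q) * gaussCoeff p q r n -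
      (r - p) * (r - q) * gaussCoeff p q (r + 1) n) = -r * N * gaussCoeff p q r N := by
    intro N
    induction N with
    | zero => simp
    | succ N ih =>
      rw [Finset.sum_range_succ, ih]
      have e1 := gaussCoeff_succ (p := p) (q := q) hr N
      have e2 := gaussCoeff_add_one (p := p) (q := q) hr N
      have h2 : r + N ≠ 0 := fun h => hr N (by linarith)
      apply mul_left_cancel₀ h2
      push_cast
      linear_combination r * e1 + (r - p) * (r - q) * e2
  have hlim : Tendsto (fun N : ℕ => -r * (N : ℝ) * gaussCoeff p q r N) atTop (𝓝 0) := by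
    rw [← tendsto_add_atTop_iff_nat 1]
    have t1 := tendsto_gaussCoeff_mul_rpow p q hr
    have t2 : Tendsto (fun n : ℕ => (n : ℝ) ^ (-(r - p - q))) atTop (𝓝 0) :=
      (tendsto_rpow_neg_atTop h).comp tendsto_natCast_atTop_atTop
    have t3 : Tendsto (fun n : ℕ => 1 + 1 / (n : ℝ)) atTop (𝓝 (1 + 0)) :=
      tendsto_const_nhds.add tendsto_one_div_atTop_nhds_zero_nat
    have t4 := ((t1.mul t2).mul t3).const_mul (-r)
    simp only [mul_zero, zero_mul] at t4
    refine t4.congr' ?_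
    filter_upwards [eventually_ge_atTop 1] with n hn
    have hn' : (0 : ℝ) < n := by exact_mod_cast hn
    have e : (n : ℝ) ^ (1 + r - p - q) * (n : ℝ) ^ (-(r - p - q)) = n := by
      rw [← Real.rpow_add hn']
      ring_nf
      exact Real.rpow_one _
    rw [mul_assoc (gaussCoeff p q r (n + 1)), e]
    push_cast
    field_simp
  have := tendsto_nhds_unique (hsum.tendsto_sum_nat.congr hpart) hlim
  linarith

/-- Every coefficient except the zeroth vanishes as the lower parameter grows. -/
lemma tendsto_tsum_gaussCoeff_add_natCast (p q r : ℝ) :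
    Tendsto (fun m : ℕ => ∑' n, gaussCoeff p q (r + m) n) atTop (𝓝 1) := by
  -- The series with lower parameter `R` converges absolutely and dominates as soon as `r + m ≥ R`.
  obtain ⟨R, hR0, hR⟩ : ∃ R : ℝ, 0 < R ∧ 0 < R - p - q :=
    ⟨|p + q| + 1, by positivity, by linarith [le_abs_self (p + q)]⟩
  have hs := (summable_gaussCoeff (p := p) (q := q) (notNonposInt_of_pos hR0) hR).norm
  have hshift : Tendsto (fun m : ℕ => r + (m : ℝ)) atTop atTop :=
    tendsto_atTop_add_const_left _ _ tendsto_natCast_atTop_atTop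
  have h1 : ∑' n : ℕ, (if n = 0 then (1 : ℝ) else 0) = 1 := tsum_ite_eq 0 _
  rw [← h1]
  refine tendsto_tsum_of_dominated_convergence hs (fun n => ?_) ?_
  · rcases n with _ | n
    · simp [gaussCoeff, pochhammer_zero]
    · simp only [Nat.add_eq_zero_iff, one_ne_zero, and_false, if_false]
      unfold gaussCoeff
      refine Tendsto.const_div_atTop ?_ _
      refine Tendsto.const_mul_atTop (by positivity) ?_
      refine tendsto_atTop_mono' _ ?_ hshift
      filter_upwards [hshift.eventually_ge_atTop 1] with m hm
      rw [pochhammer_eq_prod, Finset.prod_range_succ']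
      simp only [Nat.cast_zero, add_zero]
      have hone : ∏ _j ∈ Finset.range n, (1 : ℝ) ≤
          ∏ j ∈ Finset.range n, (r + m + ((j + 1 : ℕ) : ℝ)) :=
        Finset.prod_le_prod (by simp) fun j _ => by
          have : (0 : ℝ) ≤ ((j + 1 : ℕ) : ℝ) := Nat.cast_nonneg _
          linarith
      rw [Finset.prod_const_one] at hone
      exact le_mul_of_one_le_left (by linarith) hone
  · filter_upwards [hshift.eventually_ge_atTop R] with m hm n
    simp only [gaussCoeff, norm_div, norm_mul]
    have hpos := pochhammer_pos hR0 n
    have hle : pochhammer R n ≤ pochhammer (r + m) n := by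
      simp only [pochhammer_eq_prod]
      exact Finset.prod_le_prod (fun j _ => by positivity) fun j _ => by linarith
    rw [Real.norm_of_nonneg hpos.le, Real.norm_of_nonneg (hpos.le.trans hle)]
    have hf : 0 < ‖(n.factorial : ℝ)‖ := norm_pos_iff.2 (by positivity)
    gcongr

/-- The sum `₂F₁(p, q; r; 1)` does not vanish. -/
lemma tsum_gaussCoeff_ne_zero {p q r : ℝ} (hr : NotNonposInt r) (h : 0 < r - p - q)
    (hp : NotNonposInt (r - p)) (hq : NotNonposInt (r - q)) :
    ∑' n, gaussCoeff p q r n ≠ 0 := by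
  intro h0
  -- The contiguous relation carries a zero from `r` to every `r + m`, against the limit `1`.
  have hall : ∀ m : ℕ, ∑' n, gaussCoeff p q (r + m) n = 0 := by
    intro m
    induction m with
    | zero => simpa using h0
    | succ m ih =>
      have hm : (0 : ℝ) ≤ m := m.cast_nonneg
      have e := tsum_gaussCoeff_add_one (p := p) (q := q) (hr.add_natCast m) (by linarith)
      rw [ih, mul_zero, eq_comm, mul_eq_zero, mul_eq_zero] at e
      have e1 : r + m - p ≠ 0 := fun h => hp m (by linarith)
      have e2 : r + m - q ≠ 0 := fun h => hq m (by linarith)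
      simp only [e1, e2, or_self, false_or] at e
      push_cast
      rwa [← add_assoc]
  have := tendsto_tsum_gaussCoeff_add_natCast p q r
  simp only [hall] at this
  exact zero_ne_one (tendsto_nhds_unique tendsto_const_nhds this)

/-! ### The Gauss function on the unit interval and near `1` -/

lemma one_le_radius_ordinaryHypergeometricSeries {p q r : ℝ} (hr : NotNonposInt r) :
    1 ≤ (ordinaryHypergeometricSeries ℝ p q r).radius := by
  by_cases hp : NotNonposInt p
  · by_cases hq : NotNonposInt q
    · refine (ordinaryHypergeometricSeries_radius_eq_one ℝ p q r fun k => ⟨?_, ?_, ?_⟩).ge <;>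
        intro h
      exacts [hp k (by linarith), hq k (by linarith), hr k (by linarith)]
    · simp only [NotNonposInt, not_forall, not_not] at hq
      obtain ⟨k, rfl⟩ := hq
      simp [ordinaryHypergeometric_radius_top_of_neg_nat₂]
  · simp only [NotNonposInt, not_forall, not_not] at hp
    obtain ⟨k, rfl⟩ := hp
    simp [ordinaryHypergeometric_radius_top_of_neg_nat₁]

lemma hasFPowerSeriesOnBall_ordinaryHypergeometric {p q r : ℝ} (hr : NotNonposInt r) :
    HasFPowerSeriesOnBall (ordinaryHypergeometric p q r) (ordinaryHypergeometricSeries ℝ p q r)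
      0 1 :=
  ((ordinaryHypergeometricSeries ℝ p q r).hasFPowerSeriesOnBall (one_pos.trans_le
    (one_le_radius_ordinaryHypergeometricSeries hr))).mono one_pos
    (one_le_radius_ordinaryHypergeometricSeries hr)

lemma continuousOn_ordinaryHypergeometric {p q r : ℝ} (hr : NotNonposInt r) :
    ContinuousOn (ordinaryHypergeometric p q r) (Ioo (-1 : ℝ) 1) := by
  refine (hasFPowerSeriesOnBall_ordinaryHypergeometric hr).continuousOn.mono fun x hx => ?_
  simpa [enorm_eq_nnnorm, ← NNReal.coe_lt_coe, abs_lt] using hx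

/-- The coefficients of `(1 - x) ^ (-s)`. -/
lemma hasSum_gaussCoeff_one_one (s : ℝ) {x : ℝ} (hx0 : 0 ≤ x) (hx1 : x < 1) :
    HasSum (fun n => gaussCoeff s 1 1 n * x ^ n) ((1 - x) ^ (-s)) := by
  have h := (Real.one_div_one_sub_rpow_hasFPowerSeriesOnBall_zero s).hasSum (y := x)
    (by simpa [enorm_eq_nnnorm, ← NNReal.coe_lt_coe, abs_lt] using ⟨by linarith, hx1⟩)
  simp only [zero_add] at h
  rw [one_div, ← Real.rpow_neg (by linarith)] at h
  have hcoeff : ∀ n : ℕ, Ring.choose (s + n - 1) n = gaussCoeff s 1 1 n := fun n => by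
    have h1 := Ring.factorial_nsmul_multichoose_eq_ascPochhammer s n
    rw [Polynomial.ascPochhammer_smeval_eq_eval] at h1
    rw [Ring.choose, gaussCoeff, pochhammer_one, pochhammer, ← h1, nsmul_eq_mul,
      show s + n - 1 - n + 1 = s by ring]
    field_simp
  simpa only [FormalMultilinearSeries.ofScalars_apply_eq, smul_eq_mul, hcoeff] using h

/-- Comparison of power series with nonnegative coefficients tending to infinity at `1`. -/
lemma eventually_le_abs_tsum_of_tendsto {c d : ℕ → ℝ} {D : ℝ → ℝ} {L : ℝ} (hL : L ≠ 0)
    (hd : ∀ n, 0 ≤ d n)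
    (hD : ∀ x ∈ Ioo (0 : ℝ) 1, HasSum (fun n => d n * x ^ n) (D x))
    (hDtop : Tendsto D (𝓝[<] 1) atTop)
    (hcd : (fun n => c n - L * d n) =o[atTop] d) :
    ∀ᶠ x in 𝓝[<] (1 : ℝ), |L| / 2 * D x ≤ |∑' n, c n * x ^ n| := by
  have hL' : 0 < |L| := abs_pos.2 hL
  -- Of `|L| * D x`, the tail error and the first `N` terms each cost at most a quarter, leaving
  -- half.
  obtain ⟨N, hN⟩ := eventually_atTop.1 (hcd.def (show 0 < |L| / 4 by positivity))
  set E : ℝ := ∑ n ∈ Finset.range N, |c n - L * d n| with hE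
  have hmem : ∀ᶠ x : ℝ in 𝓝[<] 1, x ∈ Ioo (0 : ℝ) 1 := Ioo_mem_nhdsLT one_pos
  filter_upwards [hmem, hDtop.eventually_ge_atTop (4 / |L| * E)] with x hx hDx
  have hbd : ∀ n, |(c n - L * d n) * x ^ n| ≤
      |L| / 4 * (d n * x ^ n) + if n ∈ Finset.range N then |c n - L * d n| else 0 := by
    intro n
    have hxn : 0 ≤ x ^ n := pow_nonneg hx.1.le n
    have hxn1 : x ^ n ≤ 1 := pow_le_one₀ hx.1.le hx.2.le
    rw [abs_mul, abs_of_nonneg hxn]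
    split_ifs with hn
    · have h1 : 0 ≤ |L| / 4 * (d n * x ^ n) := by
        have := hd n
        positivity
      have h2 := mul_le_of_le_one_right (abs_nonneg (c n - L * d n)) hxn1
      linarith
    · have h3 := hN n (by simpa using hn)
      rw [Real.norm_eq_abs, Real.norm_eq_abs, abs_of_nonneg (hd n)] at h3
      rw [add_zero, ← mul_assoc]
      gcongr
  have hsE : HasSum (fun n => if n ∈ Finset.range N then |c n - L * d n| else 0) E := by
    rw [hE, Finset.sum_congr rfl (g := fun n =>
      if n ∈ Finset.range N then |c n - L * d n| else 0) fun n hn => by rw [if_pos hn]]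
    exact hasSum_sum_of_ne_finset_zero fun n hn => by rw [if_neg hn]
  have hsb := ((hD x hx).mul_left (|L| / 4)).add hsE
  have hs : Summable fun n => (c n - L * d n) * x ^ n :=
    hsb.summable.of_norm_bounded hbd
  have hdiff : ‖∑' n, (c n - L * d n) * x ^ n‖ ≤ _ := tsum_of_norm_bounded hsb hbd
  have hc : ∑' n, c n * x ^ n = ∑' n, (c n - L * d n) * x ^ n + L * D x := by
    rw [← ((hD x hx).mul_left L).tsum_eq, ← hs.tsum_add ((hD x hx).mul_left L).summable]
    exact tsum_congr fun n => by ring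
  have hD0 : 0 ≤ D x := (hD x hx).nonneg fun n => mul_nonneg (hd n) (pow_nonneg hx.1.le n)
  have hEle : E ≤ |L| / 4 * D x := by
    have := mul_le_mul_of_nonneg_left hDx (show 0 ≤ |L| / 4 by positivity)
    rwa [← mul_assoc, show |L| / 4 * (4 / |L|) = 1 by field_simp, one_mul] at this
  rw [Real.norm_eq_abs] at hdiff
  have h5 : |L * D x| - |∑' n, (c n - L * d n) * x ^ n| ≤ |∑' n, c n * x ^ n| := by
    rw [hc]
    have := abs_sub_abs_le_abs_sub (L * D x) (-∑' n, (c n - L * d n) * x ^ n)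
    rw [abs_neg, sub_neg_eq_add, add_comm (L * D x)] at this
    exact this
  rw [abs_mul, abs_of_nonneg hD0] at h5
  linarith

lemma tendsto_one_sub_nhdsLT_one : Tendsto (fun x : ℝ => 1 - x) (𝓝[<] 1) (𝓝[>] 0) := by
  refine tendsto_nhdsWithin_iff.2 ⟨?_, ?_⟩
  · have : Tendsto (fun x : ℝ => 1 - x) (𝓝 1) (𝓝 (1 - 1)) := by
      exact (continuous_const.sub continuous_id).tendsto 1
    rw [sub_self] at this
    exact this.mono_left nhdsWithin_le_nhds
  · filter_upwards [self_mem_nhdsWithin] with x hx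
    simpa using hx

/-- Coefficient sequences which are asymptotically proportional to a common power. -/
lemma isLittleO_sub_of_tendsto_mul_rpow {c d : ℕ → ℝ} {s L M : ℝ} (hM : M ≠ 0)
    (hc : Tendsto (fun n : ℕ => c (n + 1) * (n : ℝ) ^ s) atTop (𝓝 L))
    (hd : Tendsto (fun n : ℕ => d (n + 1) * (n : ℝ) ^ s) atTop (𝓝 M)) :
    (fun n => c n - L / M * d n) =o[atTop] d := by
  have hdne : ∀ᶠ n : ℕ in atTop, d (n + 1) * (n : ℝ) ^ s ≠ 0 := hd.eventually_ne hM
  have hd0 : ∀ᶠ n : ℕ in atTop, d n ≠ 0 := by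
    rw [← map_add_atTop_eq_nat 1]
    exact hdne.mono fun n hn => left_ne_zero_of_mul hn
  rw [Asymptotics.isLittleO_iff_tendsto' (hd0.mono fun n hn h => absurd h hn),
    ← tendsto_add_atTop_iff_nat 1]
  have := (hc.div hd hM).sub_const (L / M)
  rw [sub_self] at this
  refine this.congr' ?_
  filter_upwards [hdne] with n hn
  have h1 := left_ne_zero_of_mul hn
  have h2 := right_ne_zero_of_mul hn
  simp only [Pi.div_apply]
  field_simp

/-- A lower bound for `|₂F₁(p, q; r; x)|` near `x = 1`. -/
lemma exists_eventually_le_abs_ordinaryHypergeometric {p q r : ℝ} (hr : NotNonposInt r)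
    (h : (0 ≤ r - p - q ∧ NotNonposInt (r - p) ∧ NotNonposInt (r - q)) ∨
      (r - p - q ≤ 0 ∧ NotNonposInt p ∧ NotNonposInt q)) :
    ∃ δ > 0, ∀ᶠ x in 𝓝[<] (1 : ℝ),
      δ * (1 - x) ^ (-(max (p + q - r) 0)) ≤ |ordinaryHypergeometric p q r x| := by
  simp only [ordinaryHypergeometric_eq_tsum_gaussCoeff]
  rcases lt_trichotomy (r - p - q) 0 with hs | hs | hs
  · obtain ⟨-, hp, hq⟩ := h.resolve_left fun h => absurd h.1 hs.not_ge
    have hs' : 0 < p + q - r := by linarith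
    have hc := tendsto_gaussCoeff_mul_rpow p q hr
    have hd := tendsto_gaussCoeff_mul_rpow (p + q - r) 1 (notNonposInt_of_pos one_pos)
    -- The coefficients of `(1 - x) ^ (-(p + q - r))` decay with the same exponent as those of
    -- `₂F₁`.
    rw [show (1 : ℝ) + 1 - (p + q - r) - 1 = 1 + r - p - q by ring] at hd
    simp only [Real.Gamma_one, inv_one, mul_one, div_one] at hd
    have hM := Gamma_inv_ne_zero (notNonposInt_of_pos hs')
    have hL := div_ne_zero (mul_ne_zero (Gamma_inv_ne_zero hp) (Gamma_inv_ne_zero hq))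
      (Gamma_inv_ne_zero hr)
    refine ⟨_, half_pos (abs_pos.2 (div_ne_zero hL hM)), ?_⟩
    rw [max_eq_left hs'.le]
    refine eventually_le_abs_tsum_of_tendsto (div_ne_zero hL hM) (fun n => ?_)
      (fun x hx => hasSum_gaussCoeff_one_one _ hx.1.le hx.2) ?_
      (isLittleO_sub_of_tendsto_mul_rpow hM hc hd)
    · have h1 := pochhammer_pos hs' n
      have h2 := pochhammer_pos one_pos n
      unfold gaussCoeff
      positivity
    · exact (tendsto_rpow_neg_nhdsGT_zero (by linarith)).comp tendsto_one_sub_nhdsLT_one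
  · obtain ⟨hp, hq⟩ : NotNonposInt p ∧ NotNonposInt q := by
      rcases h with ⟨-, h1, h2⟩ | ⟨-, h1, h2⟩
      · rw [show r - p = q by linarith] at h1
        rw [show r - q = p by linarith] at h2
        exact ⟨h2, h1⟩
      · exact ⟨h1, h2⟩
    have hc := tendsto_gaussCoeff_mul_rpow p q hr
    rw [show 1 + r - p - q = 1 by linarith] at hc
    -- The comparison series is `-log (1 - x)`; its constant coefficient is `1 / 0 = 0`.
    have hd : Tendsto (fun n : ℕ => (fun k : ℕ => 1 / (k : ℝ)) (n + 1) * (n : ℝ) ^ (1 : ℝ))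
        atTop (𝓝 1) := by
      refine (tendsto_natCast_div_add_atTop (1 : ℝ)).congr fun n => ?_
      push_cast
      rw [Real.rpow_one]
      ring
    have hL := div_ne_zero (mul_ne_zero (Gamma_inv_ne_zero hp) (Gamma_inv_ne_zero hq))
      (Gamma_inv_ne_zero hr)
    have hL1 := div_ne_zero hL one_ne_zero
    have hDtop : Tendsto (fun x : ℝ => -Real.log (1 - x)) (𝓝[<] 1) atTop :=
      tendsto_neg_atBot_atTop.comp (Real.tendsto_log_nhdsGT_zero.comp tendsto_one_sub_nhdsLT_one)
    have key := eventually_le_abs_tsum_of_tendsto hL1 (d := fun k : ℕ => 1 / (k : ℝ))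
      (fun n => by positivity) (D := fun x => -Real.log (1 - x)) (fun x hx => ?_) hDtop
      (isLittleO_sub_of_tendsto_mul_rpow one_ne_zero hc hd)
    · refine ⟨_, half_pos (abs_pos.2 hL1), ?_⟩
      -- The logarithmic growth is discarded: a constant lower bound suffices, the exponent being
      -- `0`.
      filter_upwards [key, hDtop.eventually_ge_atTop 1] with x hx hx1
      rw [max_eq_right (by linarith), neg_zero, Real.rpow_zero]
      refine le_trans ?_ hx
      gcongr
    · rw [← hasSum_nat_add_iff' 1]
      simpa [div_eq_inv_mul] using
        Real.hasSum_pow_div_log_of_abs_lt_one (abs_lt.2 ⟨by linarith [hx.1], hx.2⟩)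
  · obtain ⟨-, hp, hq⟩ := h.resolve_right fun h => absurd h.1 hs.not_ge
    have hne := tsum_gaussCoeff_ne_zero hr hs hp hq
    have hsum := (summable_gaussCoeff (p := p) (q := q) hr hs).norm
    have hlim : Tendsto (fun x : ℝ => ∑' n, gaussCoeff p q r n * x ^ n) (𝓝[<] 1)
        (𝓝 (∑' n, gaussCoeff p q r n)) := by
      refine tendsto_tsum_of_dominated_convergence hsum (fun n => ?_) ?_
      · have : Tendsto (fun x : ℝ => gaussCoeff p q r n * x ^ n) (𝓝 1)
            (𝓝 (gaussCoeff p q r n * 1 ^ n)) := by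
          exact (continuous_const.mul (continuous_pow n)).tendsto 1
        rw [one_pow, mul_one] at this
        exact this.mono_left nhdsWithin_le_nhds
      · filter_upwards [Ioo_mem_nhdsLT (one_pos : (0 : ℝ) < 1)] with x hx n
        rw [norm_mul, norm_pow, Real.norm_of_nonneg hx.1.le]
        exact mul_le_of_le_one_right (norm_nonneg _) (pow_le_one₀ hx.1.le hx.2.le)
    refine ⟨_, half_pos (abs_pos.2 hne), ?_⟩
    filter_upwards [hlim.abs.eventually (eventually_ge_nhds (half_lt_self (abs_pos.2 hne)))]
      with x hx
    rwa [max_eq_right (by linarith), neg_zero, Real.rpow_zero, mul_one]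

/-! ### Necessity: integrability at the endpoints -/

lemma neg_one_lt_of_integrableOn_of_le_nhdsGT_zero {f : ℝ → ℝ} {c s : ℝ} (hc : 0 < c)
    (hf : IntegrableOn f (Ioo 0 1)) (h : ∀ᶠ x in 𝓝[>] (0 : ℝ), c * x ^ s ≤ |f x|) : -1 < s := by
  obtain ⟨ε, hε, hsub⟩ := (mem_nhdsGT_iff_exists_Ioo_subset' (one_pos : (0 : ℝ) < 1)).1
    (inter_mem h (Ioo_mem_nhdsGT (one_pos : (0 : ℝ) < 1)))
  rw [← intervalIntegral.integrableOn_Ioo_rpow_iff hε]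
  have hfε : IntegrableOn f (Ioo 0 ε) := hf.mono_set fun x hx => (hsub hx).2
  refine (hfε.norm.const_mul c⁻¹).mono' (by fun_prop) ?_
  refine ae_restrict_of_forall_mem measurableSet_Ioo fun x hx => ?_
  rw [Real.norm_of_nonneg (Real.rpow_nonneg hx.1.le s), inv_mul_eq_div, le_div_iff₀ hc, mul_comm]
  exact (hsub hx).1

lemma neg_one_lt_of_integrableOn_of_le_nhdsLT_one {f : ℝ → ℝ} {c s : ℝ} (hc : 0 < c)
    (hf : IntegrableOn f (Ioo 0 1)) (h : ∀ᶠ x in 𝓝[<] (1 : ℝ), c * (1 - x) ^ s ≤ |f x|) :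
    -1 < s := by
  have hf' : IntegrableOn (fun x => f (1 - x)) (Ioo 0 1) := by
    rw [← intervalIntegrable_iff_integrableOn_Ioo_of_le zero_le_one] at hf ⊢
    simpa using (hf.comp_sub_left 1 (by finiteness)).symm
  refine neg_one_lt_of_integrableOn_of_le_nhdsGT_zero hc hf' ?_
  have ht : Tendsto (fun x : ℝ => 1 - x) (𝓝[>] 0) (𝓝[<] 1) := by
    refine tendsto_nhdsWithin_iff.2 ⟨?_, ?_⟩
    · have : Tendsto (fun x : ℝ => 1 - x) (𝓝 0) (𝓝 (1 - 0)) := by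
        exact (continuous_const.sub continuous_id).tendsto 0
      rw [sub_zero] at this
      exact this.mono_left nhdsWithin_le_nhds
    · filter_upwards [self_mem_nhdsWithin] with x hx
      simpa using hx
  filter_upwards [ht.eventually h] with x hx
  rwa [sub_sub_cancel] at hx

lemma pos_of_integrableOn_betaHypergeometricDensity {a b p q r : ℝ} (hr : NotNonposInt r)
    (hint : IntegrableOn (betaHypergeometricDensity a b p q r) (Ioo 0 1)) : 0 < a := by
  have hF : Tendsto (fun x : ℝ => (1 - x) ^ (b - 1) * ordinaryHypergeometric p q r x) (𝓝 0)
      (𝓝 1) := by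
    have h1 : ContinuousAt (fun x : ℝ => (1 - x) ^ (b - 1)) 0 :=
      ContinuousAt.rpow_const (by fun_prop) (by norm_num)
    have h2 := (continuousOn_ordinaryHypergeometric (p := p) (q := q) hr).continuousAt
      (Ioo_mem_nhds (by norm_num) one_pos : Ioo (-1 : ℝ) 1 ∈ 𝓝 0)
    simpa using Tendsto.mul h1 h2
  have := neg_one_lt_of_integrableOn_of_le_nhdsGT_zero (c := 1 / 2) (s := a - 1) (by norm_num)
    hint ?_
  · linarith
  · filter_upwards [(hF.mono_left nhdsWithin_le_nhds).eventually
      (eventually_ge_nhds (show (1 / 2 : ℝ) < 1 by norm_num)), self_mem_nhdsWithin] with x hx hx0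
    have hx0' : 0 < x ^ (a - 1) := Real.rpow_pos_of_pos hx0 _
    rw [betaHypergeometricDensity, mul_assoc, abs_mul, abs_of_pos hx0', mul_comm (1 / 2 : ℝ)]
    exact mul_le_mul_of_nonneg_left (hx.trans (le_abs_self _)) hx0'.le

lemma max_lt_of_integrableOn_betaHypergeometricDensity {a b p q r : ℝ} (hr : NotNonposInt r)
    (h : (0 ≤ r - p - q ∧ NotNonposInt (r - p) ∧ NotNonposInt (r - q)) ∨
      (r - p - q ≤ 0 ∧ NotNonposInt p ∧ NotNonposInt q))
    (hint : IntegrableOn (betaHypergeometricDensity a b p q r) (Ioo 0 1)) :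
    max (p + q - r) 0 < b := by
  obtain ⟨δ, hδ, hF⟩ := exists_eventually_le_abs_ordinaryHypergeometric hr h
  have hx1 : Tendsto (fun x : ℝ => x ^ (a - 1)) (𝓝 1) (𝓝 1) := by
    have : ContinuousAt (fun x : ℝ => x ^ (a - 1)) 1 :=
      ContinuousAt.rpow_const (by fun_prop) (by norm_num)
    simpa [ContinuousAt] using this
  have := neg_one_lt_of_integrableOn_of_le_nhdsLT_one (c := 1 / 2 * δ)
    (s := (b - 1) + -(max (p + q - r) 0)) (by positivity) hint ?_
  · linarith
  · filter_upwards [hF, (hx1.mono_left nhdsWithin_le_nhds).eventually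
      (eventually_ge_nhds (show (1 / 2 : ℝ) < 1 by norm_num)),
      Ioo_mem_nhdsLT (one_pos : (0 : ℝ) < 1)] with x hxF hxa hx
    have hx1 : 0 < 1 - x := by linarith [hx.2]
    have hb := Real.rpow_pos_of_pos hx1 (b - 1)
    have hm := Real.rpow_pos_of_pos hx1 (-(max (p + q - r) 0))
    rw [betaHypergeometricDensity, abs_mul, abs_mul, abs_of_pos hb,
      abs_of_pos (Real.rpow_pos_of_pos hx.1 _), Real.rpow_add hx1]
    calc 1 / 2 * δ * ((1 - x) ^ (b - 1) * (1 - x) ^ (-(max (p + q - r) 0)))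
        = 1 / 2 * (1 - x) ^ (b - 1) * (δ * (1 - x) ^ (-(max (p + q - r) 0))) := by ring
      _ ≤ _ := by gcongr

/-! ### Sufficiency: Beta integrals and termwise integration -/

lemma Gamma_add_natCast {t : ℝ} (ht : 0 < t) (n : ℕ) :
    Real.Gamma (t + n) = pochhammer t n * Real.Gamma t := by
  induction n with
  | zero => simp [pochhammer_zero]
  | succ n ih =>
    push_cast
    rw [← add_assoc, Real.Gamma_add_one (by positivity), ih, pochhammer_succ]
    ring

lemma beta_add_natCast {a b : ℝ} (ha : 0 < a) (hb : 0 < b) (n : ℕ) :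
    ProbabilityTheory.beta (a + n) b =
      ProbabilityTheory.beta a b * (pochhammer a n / pochhammer (a + b) n) := by
  have h1 := pochhammer_pos (add_pos ha hb) n
  have h2 := Real.Gamma_pos_of_pos (add_pos ha hb)
  rw [ProbabilityTheory.beta, ProbabilityTheory.beta, add_right_comm, Gamma_add_natCast ha,
    Gamma_add_natCast (add_pos ha hb)]
  field_simp

/-- Both claims are read off from the Beta density having total mass `1`. -/
lemma hasIntegral_beta {a b : ℝ} (ha : 0 < a) (hb : 0 < b) :
    IntegrableOn (fun x : ℝ => x ^ (a - 1) * (1 - x) ^ (b - 1)) (Ioo 0 1) ∧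
      ∫ x in Ioo (0 : ℝ) 1, x ^ (a - 1) * (1 - x) ^ (b - 1) = ProbabilityTheory.beta a b := by
  set B := ProbabilityTheory.beta a b with hB
  have hBpos : 0 < B := ProbabilityTheory.beta_pos ha hb
  have h1 := ProbabilityTheory.lintegral_betaPDF_eq_one ha hb
  rw [ProbabilityTheory.lintegral_betaPDF] at h1
  have hnn : 0 ≤ᵐ[volume.restrict (Ioo (0 : ℝ) 1)]
      fun x : ℝ => 1 / B * x ^ (a - 1) * (1 - x) ^ (b - 1) := by
    refine ae_restrict_of_forall_mem measurableSet_Ioo fun x hx => ?_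
    have h2 := Real.rpow_nonneg hx.1.le (a - 1)
    have h3 := Real.rpow_nonneg (sub_nonneg.2 hx.2.le) (b - 1)
    simp only [Pi.zero_apply]
    positivity
  have hmeas : AEStronglyMeasurable (fun x : ℝ => 1 / B * x ^ (a - 1) * (1 - x) ^ (b - 1))
      (volume.restrict (Ioo (0 : ℝ) 1)) := Measurable.aestronglyMeasurable (by fun_prop)
  have hint : Integrable (fun x : ℝ => 1 / B * x ^ (a - 1) * (1 - x) ^ (b - 1))
      (volume.restrict (Ioo (0 : ℝ) 1)) := by
    refine ⟨hmeas, ?_⟩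
    rw [hasFiniteIntegral_iff_ofReal hnn, h1]
    exact ENNReal.one_lt_top
  have hval : ∫ x in Ioo (0 : ℝ) 1, 1 / B * x ^ (a - 1) * (1 - x) ^ (b - 1) = 1 := by
    rw [integral_eq_lintegral_of_nonneg_ae hnn hmeas, h1, ENNReal.toReal_one]
  have e : (fun x : ℝ => x ^ (a - 1) * (1 - x) ^ (b - 1)) =
      fun x => B * (1 / B * x ^ (a - 1) * (1 - x) ^ (b - 1)) := by
    ext x
    field_simp
  refine ⟨?_, ?_⟩
  · rw [e]
    exact hint.const_mul B
  · rw [e, integral_const_mul, hval, mul_one]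

/-- Tonelli for the norms bounds the integral of the norm of the sum. -/
lemma integrable_tsum_of_summable_integral_norm {α : Type*} [MeasurableSpace α] {μ : Measure α}
    {F : ℕ → α → ℝ} (hF : ∀ n, Integrable (F n) μ) (hsum : Summable fun n => ∫ x, ‖F n x‖ ∂μ)
    (hmeas : AEStronglyMeasurable (fun x => ∑' n, F n x) μ) :
    Integrable (fun x => ∑' n, F n x) μ := by
  refine ⟨hmeas, ?_⟩
  have h1 : ∀ n, ∫⁻ x, ‖F n x‖ₑ ∂μ = ENNReal.ofReal (∫ x, ‖F n x‖ ∂μ) := fun n =>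
    (ofReal_integral_norm_eq_lintegral_enorm (hF n)).symm
  calc ∫⁻ x, ‖∑' n, F n x‖ₑ ∂μ ≤ ∫⁻ x, ∑' n, ‖F n x‖ₑ ∂μ :=
        lintegral_mono fun x => enorm_tsum_le_tsum_enorm
    _ = ∑' n, ∫⁻ x, ‖F n x‖ₑ ∂μ := lintegral_tsum fun n => (hF n).1.enorm
    _ = ∑' n, ENNReal.ofReal (∫ x, ‖F n x‖ ∂μ) := tsum_congr h1
    _ < ⊤ := hsum.tsum_ofReal_lt_top

lemma integral_betaHypergeometricDensity {a b p q r : ℝ} (hr : NotNonposInt r) (ha : 0 < a)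
    (hb : 0 < b) (h : 0 < r + b - p - q) :
    IntegrableOn (betaHypergeometricDensity a b p q r) (Ioo 0 1) volume ∧
      Summable (hypergeometric3F2Term p q a r (a + b) 1) ∧
      ∫ x in Ioo (0 : ℝ) 1, betaHypergeometricDensity a b p q r x =
        ProbabilityTheory.beta a b * hypergeometric3F2 p q a r (a + b) 1 := by
  have hs : Summable (hypergeometric3F2Term p q a r (a + b) 1) :=
    summable_hypergeometric3F2Term hr (notNonposInt_of_pos (add_pos ha hb)) (by linarith)
  set F : ℕ → ℝ → ℝ := fun n x =>
    gaussCoeff p q r n * (x ^ (a + n - 1) * (1 - x) ^ (b - 1)) with hFdef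
  have hcongr : ∀ x ∈ Ioo (0 : ℝ) 1, ∑' n, F n x = betaHypergeometricDensity a b p q r x := by
    intro x hx
    rw [betaHypergeometricDensity, ordinaryHypergeometric_eq_tsum_gaussCoeff, ← tsum_mul_left]
    refine tsum_congr fun n => ?_
    rw [hFdef]
    simp only
    rw [show a + n - 1 = (a - 1) + n by ring, Real.rpow_add_natCast hx.1.ne']
    ring
  have hbeta : ∀ n : ℕ, _ := fun n =>
    hasIntegral_beta (a := a + n) (b := b) (by positivity) hb
  have hFint : ∀ n, Integrable (F n) (volume.restrict (Ioo 0 1)) := fun n =>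
    (hbeta n).1.const_mul _
  have hterm : ∀ n, gaussCoeff p q r n * ProbabilityTheory.beta (a + n) b =
      ProbabilityTheory.beta a b * hypergeometric3F2Term p q a r (a + b) 1 n := by
    intro n
    rw [beta_add_natCast ha hb, gaussCoeff, hypergeometric3F2Term, one_pow, mul_one]
    have h1 := pochhammer_ne_zero hr n
    have h2 := (pochhammer_pos (add_pos ha hb) n).ne'
    field_simp
  have hFval : ∀ n, ∫ x in Ioo (0 : ℝ) 1, F n x =
      ProbabilityTheory.beta a b * hypergeometric3F2Term p q a r (a + b) 1 n := by
    intro n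
    rw [← hterm, hFdef, integral_const_mul, (hbeta n).2]
  have hFnorm : ∀ n, ∫ x in Ioo (0 : ℝ) 1, ‖F n x‖ =
      |ProbabilityTheory.beta a b * hypergeometric3F2Term p q a r (a + b) 1 n| := by
    intro n
    have e : ∀ x ∈ Ioo (0 : ℝ) 1, ‖F n x‖ =
        |gaussCoeff p q r n| * (x ^ (a + n - 1) * (1 - x) ^ (b - 1)) := by
      intro x hx
      have h2 := Real.rpow_nonneg hx.1.le (a + n - 1)
      have h3 := Real.rpow_nonneg (sub_nonneg.2 hx.2.le) (b - 1)
      rw [hFdef, norm_mul, Real.norm_eq_abs, Real.norm_of_nonneg (mul_nonneg h2 h3)]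
    rw [setIntegral_congr_fun measurableSet_Ioo e, integral_const_mul, (hbeta n).2, ← hterm,
      abs_mul, abs_of_pos (ProbabilityTheory.beta_pos (by positivity) hb)]
  have hFsum : Summable fun n => ∫ x in Ioo (0 : ℝ) 1, ‖F n x‖ := by
    simp only [hFnorm]
    exact (hs.mul_left _).abs
  have hcongr' : (fun x => ∑' n, F n x) =ᵐ[volume.restrict (Ioo 0 1)]
      betaHypergeometricDensity a b p q r :=
    ae_restrict_of_forall_mem measurableSet_Ioo hcongr
  have hmeas : AEStronglyMeasurable (betaHypergeometricDensity a b p q r)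
      (volume.restrict (Ioo 0 1)) := by
    have h1 : AEStronglyMeasurable (fun x : ℝ => x ^ (a - 1) * (1 - x) ^ (b - 1))
      (volume.restrict (Ioo 0 1)) := Measurable.aestronglyMeasurable (by fun_prop)
    exact h1.mul (((continuousOn_ordinaryHypergeometric hr).mono
      (Ioo_subset_Ioo_left (by norm_num))).aestronglyMeasurable measurableSet_Ioo)
  refine ⟨(integrable_tsum_of_summable_integral_norm hFint hFsum
    (hmeas.congr hcongr'.symm)).congr hcongr', hs, ?_⟩
  rw [← integral_congr_ae hcongr', ← integral_tsum_of_summable_integral_norm hFint hFsum,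
    hypergeometric3F2, ← tsum_mul_left]
  exact tsum_congr hFval

theorem proposition2p3 (a b p q r : ℝ) (hr : NotNonposInt r)
    (hpos : ∀ x ∈ Ioo (0 : ℝ) 1, 0 ≤ betaHypergeometricDensity a b p q r x) :
    ((0 < a ∧ 0 < b ∧ 0 < r + b - p - q) →
      IntegrableOn (betaHypergeometricDensity a b p q r) (Ioo 0 1) volume ∧
      Summable (hypergeometric3F2Term p q a r (a + b) 1) ∧
      ∫ x in Ioo (0 : ℝ) 1, betaHypergeometricDensity a b p q r x =
        ProbabilityTheory.beta a b * hypergeometric3F2 p q a r (a + b) 1) ∧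
    (((0 ≤ r - p - q ∧ NotNonposInt (r - p) ∧ NotNonposInt (r - q)) ∨
        (r - p - q ≤ 0 ∧ NotNonposInt p ∧ NotNonposInt q)) →
      IntegrableOn (betaHypergeometricDensity a b p q r) (Ioo 0 1) volume →
      0 < a ∧ 0 < b ∧ 0 < r + b - p - q) := by
  refine ⟨fun ⟨ha, hb, h⟩ => integral_betaHypergeometricDensity hr ha hb h, fun h hint => ?_⟩
  have hmax := max_lt_of_integrableOn_betaHypergeometricDensity hr h hint
  exact ⟨pos_of_integrableOn_betaHypergeometricDensity hr hint,
    (le_max_right _ _).trans_lt hmax, by linarith [(le_max_left (p + q - r) 0).trans_lt hmax]⟩
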